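/- Let $\mathbb{K}$ be $\mathbb{R}$ or $\mathbb{C}$, let $X, Y$ be completely regular (Hausdorff) realcompact spaces and let $E, F$ be normed spaces over $\mathbb{K}$ (not necessarily complete); assume that $X \neq \emptyset$ and $E \neq \{0\}$. Here $X$ is realcompact if every point $p$ of its Stone–Čech compactification $\beta X$ such that the continuous extension $\beta X \to \mathbb{R} \cup \{\infty\}$ of every continuous function $f : X \to \mathbb{R}$ is finite at $p$ belongs to $X$. Write $C(X,E)$ for the vector space of all continuous functions from $X$ to $E$. A $\mathbb{K}$-linear map $T : C(X,E) \to C(Y,F)$ is called separating if, for all $f, g \in C(X,E)$, $\|f(x)\|\,\|g(x)\| = 0$ for all $x \in X$ implies $\|(Tf)(y)\|\,\|(Tg)(y)\| = 0$ for all $y \in Y$; it is called biseparating if it is separating and bijective and $T^{-1}$ is separating as well. Then there exists a biseparating map $T : C(X,E) \to C(Y,F)$ if and only if $X$ and $Y$ are homeomorphic and at least one of the following two conditions holds: 1. $E$ and $F$ are isomorphic as normed spaces, that is, there is a linear homeomorphism from $E$ onto $F$; 2. $\dim E = \dim F$ (the algebraic dimensions, as cardinal numbers) and $Y$ is a $P$-space,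 that is, for every $y \in Y$ the intersection of any sequence of neighbourhoods of $y$ is again a neighbourhood of $y$. -/

import Mathlib

open Topology

universe uE uF

/-- A real-valued continuous function on `X`, viewed as a map into the compact Hausdorff space
`ℝ ∪ {∞}`, is continuous. -/
theorem continuous_coe_onePoint {X : Type*} [TopologicalSpace X] (f : C(X, ℝ)) :
    Continuous (fun x : X => ((f x : ℝ) : OnePoint ℝ)) :=
  OnePoint.continuous_coe.comp f.continuous

/-- The value at `p ∈ βX` of the continuous extension `βX → ℝ ∪ {∞}` of `f ∈ C(X)`. -/
noncomputable def betaExtend {X : Type*} [TopologicalSpace X] (f : C(X, ℝ)) :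
    StoneCech X → OnePoint ℝ :=
  stoneCechExtend (continuous_coe_onePoint f)

/-- The realcompactification `rX`: the points of `βX` at which (the extension of) every
continuous real-valued function on `X` is finite. -/
def realcompactification (X : Type*) [TopologicalSpace X] : Set (StoneCech X) :=
  {p | ∀ f : C(X, ℝ), betaExtend f p ≠ OnePoint.infty}

/-- `X` is realcompact if `rX = X` (inside `βX`). -/
def IsRealcompact (X : Type*) [TopologicalSpace X] : Prop :=
  realcompactification X = Set.range (stoneCechUnit : X → StoneCech X)

/-- A point `x` is a `P`-point if countable intersections of neighbourhoods of `x` are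
neighbourhoods of `x`. -/
def IsPPoint {X : Type*} [TopologicalSpace X] (x : X) : Prop :=
  ∀ U : ℕ → Set X, (∀ n, U n ∈ 𝓝 x) → (⋂ n, U n) ∈ 𝓝 x

/-- A `P`-space: a completely regular (Hausdorff) space all of whose points are `P`-points. -/
def IsPSpace (X : Type*) [TopologicalSpace X] : Prop :=
  T35Space X ∧ ∀ x : X, IsPPoint x

section Separating

variable {𝕜 X Y E F : Type*} [RCLike 𝕜] [TopologicalSpace X] [TopologicalSpace Y]
  [NormedAddCommGroup E] [NormedSpace 𝕜 E] [NormedAddCommGroup F] [NormedSpace 𝕜 F]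

/-- A linear map `T` is separating if `‖f(·)‖‖g(·)‖ ≡ 0` implies `‖Tf(·)‖‖Tg(·)‖ ≡ 0`. -/
def IsSeparating (T : C(X, E) →ₗ[𝕜] C(Y, F)) : Prop :=
  ∀ f g : C(X, E), (∀ x, ‖f x‖ * ‖g x‖ = 0) → ∀ y, ‖T f y‖ * ‖T g y‖ = 0

/-- `T` is biseparating if it is separating, it has an inverse, and the inverse is
separating. -/
def IsBiseparating (T : C(X, E) →ₗ[𝕜] C(Y, F)) : Prop :=
  IsSeparating T ∧
    ∃ S : C(Y, F) →ₗ[𝕜] C(X, E),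
      S ∘ₗ T = LinearMap.id ∧ T ∘ₗ S = LinearMap.id ∧ IsSeparating S

end Separating

/-!
A biseparating map `T : C(X, E) → C(Y, F)` is a weighted composition operator. Every functional
`f ↦ T f y` has a support point in the compact space `βX`, by a partition of unity
(`exists_isSupportPoint`), and it vanishes on the functions that vanish near that point. Three
facts lead from this local statement to the pointwise formula `T f y = J y (f (h y))`.

* The support point of `y` lies in the realcompactification of `X`, hence in `X`
  (`mem_realcompactification_of_isSupportPoint`); call it `h y`.
* The support maps of `T` and of `T⁻¹` are inverse to each other (`supportMap_comp_supportMap`), so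
  `h` is a homeomorphism.
* If `f (h y) = 0`, then `T f y = 0` (`map_eq_zero_of_apply_eq_zero`).

The first and the third are instances of one idea. If `r` is a real function that is unbounded near
the support point, then `r • g` is not yet controlled by `T g`, because `T` is only local. Replacing
`r` by two step functions of `r`, one of which is constant near any given point
(`exists_plateau_functions`), yields two functions `G` such that at every point one of them satisfies
`T G = ρ • T g` with a scalar `ρ` at bounded distance from `r`. If `T g y ≠ 0`, this contradicts the
continuity of the two functions `T G` at `y` (`exists_bound_of_eq_smul`).

The weights `J y : E → F` are linear bijections, whence the equality of dimensions. If some `y` is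
not a `P`-point, then `J y` and its inverse are continuous (`continuous_of_not_isPPoint`): vectors
`e n → 0` with `J y (e n)` not tending to `0` could be assembled into a continuous function `f`
vanishing at `y` and taking the values `e n` near `y`, and `z ↦ J z (f z)` would be discontinuous.

Conversely, a linear bijection `E → F` induces a biseparating map as soon as composition with it
and with its inverse preserves continuity. On a `P`-space this is automatic, since continuous
functions into metric spaces are locally constant there.
-/

/-! ### Auxiliary functions of a real variable -/

open Filter in
/-- Two functions on the line that grow like the identity and such that near every real number at
least one of them is constant with an integer value. Composing them with an unbounded function `r`
replaces `r` by functions which are locally constant on two open sets covering the space. -/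
theorem exists_plateau_functions :
    ∃ u : Bool → C(ℝ, ℝ), (∀ i r, r - 4 ≤ u i r ∧ u i r ≤ r - 2) ∧
      ∀ r, ∃ i, ∃ n : ℤ, ∀ᶠ s in 𝓝 r, u i s = n := by
  -- `v` equals `n` on `[n, n + 3/4]` and is affine on `[n + 3/4, n + 1]`.
  let w : ℝ → ℝ := fun t => max 0 (4 * t - 3) - t
  have hw : Continuous w := by fun_prop
  let v : ℝ → ℝ := fun r => r + w (Int.fract r)
  have hv : Continuous v := by
    have : Continuous (w ∘ Int.fract) :=
      ContinuousOn.comp_fract'' hw.continuousOn (by norm_num [w])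
    exact continuous_id.add this
  have hb : ∀ r, r - 1 ≤ v r ∧ v r ≤ r := by
    intro r
    have h0 := Int.fract_nonneg r
    have h1 := (Int.fract_lt_one r).le
    simp only [v, w]
    constructor
    · linarith [le_max_left 0 (4 * Int.fract r - 3)]
    · have : max 0 (4 * Int.fract r - 3) ≤ Int.fract r := max_le h0 (by linarith)
      linarith
  have hc : ∀ r, 0 < Int.fract r → Int.fract r < 3 / 4 → ∀ᶠ s in 𝓝 r, v s = ⌊r⌋ := by
    intro r h0 h1
    have hr := Int.floor_add_fract r
    filter_upwards [Ioo_mem_nhds (show (⌊r⌋ : ℝ) < r by linarith)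
      (show r < ⌊r⌋ + 3 / 4 by linarith)] with s hs
    have hf : ⌊s⌋ = ⌊r⌋ := Int.floor_eq_iff.2 ⟨hs.1.le, by linarith [hs.2]⟩
    have hfs := Int.floor_add_fract s
    rw [hf] at hfs
    have : max 0 (4 * Int.fract s - 3) = 0 := max_eq_left (by linarith [hs.2])
    simp only [v, w, this]
    linarith
  -- A shift by `1/2` moves the plateaus over the gaps; the summand `-2` gives `u i r ≤ r - 2`.
  refine ⟨fun i => ⟨fun r => v (r - cond i 0 (1 / 2)) - 2, by fun_prop⟩, ?_, ?_⟩
  · intro i r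
    have := hb (r - cond i 0 (1 / 2))
    cases i <;> simp only [ContinuousMap.coe_mk, cond_true, cond_false] at this ⊢ <;>
      constructor <;> linarith
  · intro r
    by_cases h : 0 < Int.fract r ∧ Int.fract r < 3 / 4
    · refine ⟨true, ⌊r⌋ - 2, ?_⟩
      filter_upwards [hc r h.1 h.2] with s hs
      simp [hs]
    · have hr := Int.floor_add_fract r
      have h0 := Int.fract_nonneg r
      have h1 := Int.fract_lt_one r
      have key : 0 < Int.fract (r - 1 / 2) ∧ Int.fract (r - 1 / 2) < 3 / 4 := by
        have hr' := Int.floor_add_fract (r - 1 / 2)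
        by_cases h' : 0 < Int.fract r
        · have h2 : 3 / 4 ≤ Int.fract r := by
            by_contra h2
            exact h ⟨h', not_le.1 h2⟩
          have : ⌊r - 1 / 2⌋ = ⌊r⌋ := Int.floor_eq_iff.2 ⟨by linarith, by linarith⟩
          rw [this] at hr'
          constructor <;> linarith
        · have h2 : Int.fract r = 0 := le_antisymm (not_lt.1 h') h0
          have : ⌊r - 1 / 2⌋ = ⌊r⌋ - 1 :=
            Int.floor_eq_iff.2 ⟨by push_cast; linarith, by push_cast; linarith⟩
          rw [this] at hr'
          push_cast at hr'
          constructor <;> linarith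
      refine ⟨false, ⌊r - 1 / 2⌋ - 2, ?_⟩
      have ht : Tendsto (fun s : ℝ => s - 1 / 2) (𝓝 r) (𝓝 (r - 1 / 2)) :=
        (continuous_id.sub continuous_const).tendsto r
      filter_upwards [ht.eventually (hc _ key.1 key.2)] with s hs
      simpa using hs

open Filter in
/-- A sequence tending to `0` is interpolated by a continuous (piecewise affine) path that tends
to `0` at `+∞`. -/
theorem exists_continuous_interpolation {E : Type*} [NormedAddCommGroup E] [NormedSpace ℝ E]
    (e : ℤ → E) (he : Tendsto e atTop (𝓝 0)) :
    ∃ P : C(ℝ, E), (∀ n : ℤ, P n = e n) ∧ Tendsto P atTop (𝓝 0) := by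
  let P : ℝ → E := fun s => (1 - Int.fract s) • e ⌊s⌋ + Int.fract s • e (⌊s⌋ + 1)
  have hP : ∀ n : ℤ, P n = e n := fun n => by simp [P]
  have hlf : LocallyFinite fun n : ℤ => Set.Icc (n : ℝ) (n + 1) := by
    intro s
    refine ⟨Set.Ioo (s - 1) (s + 1), Ioo_mem_nhds (by linarith) (by linarith), ?_⟩
    refine (Set.finite_Icc (⌊s⌋ - 2) (⌊s⌋ + 2)).subset ?_
    rintro n ⟨t, ht1, ht2⟩
    have h1 := Int.floor_le s
    have h2 := Int.lt_floor_add_one s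
    constructor
    · have : ((⌊s⌋ - 2 : ℤ) : ℝ) ≤ n := by push_cast; linarith [ht1.2, ht2.1]
      exact_mod_cast this
    · have : (n : ℝ) ≤ ((⌊s⌋ + 2 : ℤ) : ℝ) := by push_cast; linarith [ht1.1, ht2.2]
      exact_mod_cast this
  have hcont : Continuous P := by
    refine hlf.continuous ?_ (fun n => isClosed_Icc) ?_
    · exact Set.eq_univ_of_forall fun s =>
        Set.mem_iUnion.2 ⟨⌊s⌋, Int.floor_le s, (Int.lt_floor_add_one s).le⟩
    · intro n
      have h : ContinuousOn (fun s : ℝ => (n + 1 - s) • e n + (s - n) • e (n + 1))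
          (Set.Icc (n : ℝ) (n + 1)) := by fun_prop
      refine h.congr fun s hs => ?_
      rcases hs.2.lt_or_eq with hlt | heq
      · have hfl : ⌊s⌋ = n := Int.floor_eq_iff.2 ⟨hs.1, hlt⟩
        have hfr := Int.floor_add_fract s
        rw [hfl] at hfr
        have : Int.fract s = s - n := by linarith
        simp only [P, hfl, this]
        congr 2
        ring
      · have : P s = e (n + 1) := by
          have := hP (n + 1)
          push_cast at this
          rw [heq, this]
        rw [this, heq]
        simp
  refine ⟨⟨P, hcont⟩, hP, ?_⟩
  have h1 : Tendsto (fun s : ℝ => ‖e ⌊s⌋‖ + ‖e (⌊s⌋ + 1)‖) atTop (𝓝 0) := by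
    have ha : Tendsto (fun s : ℝ => e ⌊s⌋) atTop (𝓝 0) := he.comp tendsto_floor_atTop
    have hb : Tendsto (fun s : ℝ => e (⌊s⌋ + 1)) atTop (𝓝 0) :=
      he.comp (tendsto_atTop_add_const_right _ 1 tendsto_floor_atTop)
    simpa using ha.norm.add hb.norm
  refine squeeze_zero_norm (fun s => ?_) h1
  have h0 := Int.fract_nonneg s
  have h1 := Int.fract_lt_one s
  refine (norm_add_le _ _).trans (add_le_add ?_ ?_)
  · rw [norm_smul, Real.norm_of_nonneg (by linarith)]
    exact mul_le_of_le_one_left (norm_nonneg _) (by linarith)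
  · rw [norm_smul, Real.norm_of_nonneg h0]
    exact mul_le_of_le_one_left (norm_nonneg _) h1.le

/-- A completely regular space has bump functions. -/
theorem exists_bump {X : Type*} [TopologicalSpace X] [CompletelyRegularSpace X] {x : X} {U : Set X}
    (hU : U ∈ 𝓝 x) :
    ∃ φ : C(X, ℝ), φ x = 1 ∧ (∀ z, 0 ≤ φ z ∧ φ z ≤ 1) ∧ ∀ z, φ z ≠ 0 → z ∈ U := by
  obtain ⟨V, hVU, hV, hxV⟩ := mem_nhds_iff.1 hU
  obtain ⟨f, hf, hfx, hfV⟩ :=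
    CompletelyRegularSpace.completely_regular x Vᶜ hV.isClosed_compl (by simpa using hxV)
  refine ⟨⟨fun z => 1 - (f z : ℝ), by fun_prop⟩, by simp [hfx], fun z => ?_, fun z hz => ?_⟩
  · have := (f z).2
    exact ⟨by simpa using this.2, by simpa using this.1⟩
  · by_contra h
    exact hz (by simp [hfV (fun h' => h (hVU h') : z ∈ Vᶜ)])

section RealMul

variable (𝕜 : Type*) {X E : Type*} [RCLike 𝕜] [TopologicalSpace X]
  [NormedAddCommGroup E] [NormedSpace 𝕜 E]

/-- The product of a real-valued and a vector-valued continuous function; the real function is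
coerced to the scalar field `𝕜`. -/
noncomputable def realMul (u : C(X, ℝ)) (g : C(X, E)) : C(X, E) :=
  ⟨fun x => (u x : 𝕜) • g x, (RCLike.continuous_ofReal.comp u.continuous).smul g.continuous⟩

@[simp] theorem realMul_apply (u : C(X, ℝ)) (g : C(X, E)) (x : X) :
    realMul 𝕜 u g x = (u x : 𝕜) • g x := rfl

end RealMul

/-! ### Support points of a separating map -/

section SupportPoint

variable {𝕜 X Y E F B : Type*} [RCLike 𝕜] [TopologicalSpace X] [TopologicalSpace Y]
  [TopologicalSpace B]
  [NormedAddCommGroup E] [NormedSpace 𝕜 E] [NormedAddCommGroup F] [NormedSpace 𝕜 F]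

theorem IsSeparating.eq_zero_or {T : C(X, E) →ₗ[𝕜] C(Y, F)} (hT : IsSeparating T)
    {f g : C(X, E)} (h : ∀ x, f x = 0 ∨ g x = 0) (y : Y) : T f y = 0 ∨ T g y = 0 := by
  have := hT f g (fun x => by rcases h x with h | h <;> simp [h]) y
  simpa using this

/-- A biseparating map preserves inclusion of cozero sets up to closure. -/
theorem mem_closure_cozero [T35Space Y] {T : C(X, E) →ₗ[𝕜] C(Y, F)} {S : C(Y, F) →ₗ[𝕜] C(X, E)}
    (hT : IsSeparating T) (hS : IsSeparating S) (hST : ∀ f, S (T f) = f) (hTS : ∀ g, T (S g) = g)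
    {f g : C(X, E)} (hfg : ∀ x, g x = 0 → f x = 0) {y : Y} (hy : T f y ≠ 0) :
    y ∈ closure {z | T g z ≠ 0} := by
  by_contra hcl
  obtain ⟨φ, hφy, -, hφ⟩ := exists_bump (isClosed_closure.isOpen_compl.mem_nhds hcl)
  have h1 : ∀ x, S (realMul 𝕜 φ (T f)) x = 0 ∨ g x = 0 := by
    intro x
    have := hS.eq_zero_or (f := realMul 𝕜 φ (T f)) (g := T g) (fun z => ?_) x
    · rwa [hST] at this
    · by_cases hz : T g z = 0
      · exact Or.inr hz
      · have : φ z = 0 := by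
          by_contra h
          exact hφ z h (subset_closure hz)
        simp [this]
  have h2 := hT.eq_zero_or (f := S (realMul 𝕜 φ (T f))) (g := f)
    (fun x => (h1 x).imp_right (hfg x)) y
  rw [hTS] at h2
  simp [hφy, hy] at h2

/-- For `ι : X → B`, the point `p : B` is a support point of the functional `f ↦ T f y` if this
functional does not vanish on the functions concentrated on the preimage under `ι` of any given
neighbourhood of `p`. -/
def IsSupportPoint (T : C(X, E) →ₗ[𝕜] C(Y, F)) (ι : X → B) (y : Y) (p : B) : Prop :=
  ∀ U ∈ 𝓝 p, ∃ f : C(X, E), (∀ x, f x ≠ 0 → ι x ∈ U) ∧ T f y ≠ 0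

/-- Support points in a compact space exist: otherwise a partition of unity subordinate to a finite
cover would show that the functional vanishes. -/
theorem exists_isSupportPoint [CompactSpace B] [T2Space B] (T : C(X, E) →ₗ[𝕜] C(Y, F))
    {ι : X → B} (hι : Continuous ι) {y : Y} {f : C(X, E)} (hf : T f y ≠ 0) :
    ∃ p, IsSupportPoint T ι y p := by
  by_contra hcon
  simp only [IsSupportPoint, not_exists, not_forall, not_and, not_not] at hcon
  choose U hU hUT using hcon
  obtain ⟨t, ht⟩ := (isCompact_univ (X := B)).elim_nhds_subcover (fun p => interior (U p))
    (fun p _ => interior_mem_nhds.2 (hU p))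
  obtain ⟨ρ, hρ⟩ := PartitionOfUnity.exists_isSubordinate_of_locallyFinite
    (isClosed_univ (X := B)) (fun p : t => interior (U p)) (fun _ => isOpen_interior)
    (locallyFinite_of_finite _) (fun q hq => by
      obtain ⟨p, hp, hqp⟩ := Set.mem_iUnion₂.1 (ht.2 hq)
      exact Set.mem_iUnion.2 ⟨⟨p, hp⟩, hqp⟩)
  have hsum : f = ∑ p : t, realMul 𝕜 ((ρ p).comp ⟨ι, hι⟩) f := by
    ext x
    have h1 := ρ.sum_eq_one (Set.mem_univ (ι x))
    rw [finsum_eq_sum_of_fintype] at h1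
    simp only [ContinuousMap.coe_sum, Finset.sum_apply, realMul_apply, ContinuousMap.comp_apply,
      ContinuousMap.coe_mk]
    rw [← Finset.sum_smul, ← RCLike.ofReal_sum, h1]
    simp
  apply hf
  rw [hsum, map_sum, ContinuousMap.coe_sum, Finset.sum_apply]
  refine Finset.sum_eq_zero fun p _ => hUT p _ fun x hx => ?_
  refine interior_subset (hρ p (subset_tsupport _ ?_))
  intro h0
  apply hx
  have : ρ p (ι x) = 0 := h0
  simp [this]

namespace IsSupportPoint

variable {T : C(X, E) →ₗ[𝕜] C(Y, F)} {ι : X → B} {y : Y} {p : B}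

/-- Functions vanishing near a support point are in the kernel of the functional. -/
theorem map_eq_zero (hp : IsSupportPoint T ι y p) (hT : IsSeparating T) {f : C(X, E)}
    (hf : ∀ᶠ q in 𝓝 p, ∀ x, ι x = q → f x = 0) : T f y = 0 := by
  obtain ⟨g, hg, hgy⟩ := hp _ hf
  refine (hT.eq_zero_or (fun x => ?_) y).resolve_right hgy
  by_cases h : g x = 0
  · exact Or.inr h
  · exact Or.inl (hg x h x rfl)

theorem map_congr (hp : IsSupportPoint T ι y p) (hT : IsSeparating T) {f g : C(X, E)}
    (hf : ∀ᶠ q in 𝓝 p, ∀ x, ι x = q → f x = g x) : T f y = T g y := by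
  have := hp.map_eq_zero hT (f := f - g) (hf.mono fun q hq x hx => by simp [hq x hx])
  rw [map_sub, ContinuousMap.sub_apply, sub_eq_zero] at this
  exact this

end IsSupportPoint

theorem continuous_of_isSupportPoint [RegularSpace B] {T : C(X, E) →ₗ[𝕜] C(Y, F)} {ι : X → B}
    (hT : IsSeparating T) {h : Y → B} (hh : ∀ y, IsSupportPoint T ι y (h y)) : Continuous h := by
  rw [continuous_iff_continuousAt]
  intro y U hU
  rw [Filter.mem_map]
  obtain ⟨V, ⟨hV, hVc⟩, hVU⟩ := (closed_nhds_basis (h y)).mem_iff.1 hU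
  obtain ⟨f, hf, hfy⟩ := hh y V hV
  filter_upwards [(T f).continuous.continuousAt.eventually_ne hfy] with z hz
  by_contra hzU
  have hzV : h z ∉ V := fun h => hzU (hVU h)
  refine hz ((hh z).map_eq_zero hT ?_)
  filter_upwards [hVc.isOpen_compl.mem_nhds hzV] with q hq x hx
  by_contra h0
  exact hq (hx ▸ hf x h0)

/-- If functions `H i` satisfy `H i z = u i r • K z` at points `z` near a point where `K` does not
vanish, then the numbers `r` arising in this way are bounded above. -/
theorem exists_bound_of_eq_smul {u : Bool → C(ℝ, ℝ)} (hu : ∀ i r, r - 4 ≤ u i r)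
    (H : Bool → C(Y, F)) {K : C(Y, F)} {y : Y} (hK : K y ≠ 0) :
    ∃ R : ℝ, ∀ᶠ z in 𝓝 y, ∀ i r, H i z = ((u i r : ℝ) : 𝕜) • K z → r ≤ R := by
  have hδ : 0 < ‖K y‖ / 2 := half_pos (norm_pos_iff.2 hK)
  let M : ℝ := ‖H true y‖ + ‖H false y‖ + 1
  have hM : 0 ≤ M := by positivity
  have hHM : ∀ i, ∀ᶠ z in 𝓝 y, ‖H i z‖ < M := by
    intro i
    refine (H i).continuous.norm.continuousAt.eventually_lt_const ?_
    have h1 := norm_nonneg (H true y)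
    have h2 := norm_nonneg (H false y)
    cases i <;> simp only [M] <;> linarith
  refine ⟨M / (‖K y‖ / 2) + 4, ?_⟩
  filter_upwards [Filter.eventually_all.2 hHM, K.continuous.norm.continuousAt.eventually_const_lt
    (half_lt_self (norm_pos_iff.2 hK))] with z hz hKz i r hr
  rw [← sub_le_iff_le_add, le_div_iff₀ hδ]
  rcases le_total (r - 4) 0 with h0 | h0
  · exact (mul_nonpos_of_nonpos_of_nonneg h0 hδ.le).trans hM
  · have h1 : ‖H i z‖ = |u i r| * ‖K z‖ := by rw [hr, norm_smul, RCLike.norm_ofReal]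
    calc (r - 4) * (‖K y‖ / 2) ≤ |u i r| * ‖K z‖ :=
          mul_le_mul ((hu i r).trans (le_abs_self _)) hKz.le hδ.le (abs_nonneg _)
      _ ≤ M := h1 ▸ (hz i).le

end SupportPoint

/-! ### Support points lie in the realcompactification -/

section Realcompact

variable {𝕜 X Y E F : Type*} [RCLike 𝕜] [TopologicalSpace X] [TopologicalSpace Y]
  [NormedAddCommGroup E] [NormedSpace 𝕜 E] [NormedAddCommGroup F] [NormedSpace 𝕜 F]

/-- Suppose that the extension of `f` is infinite at the support point of `y`. The functions
`u i ∘ |f| • g` show that the finite values of `|f|` at the support points near `y` are bounded, so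
by continuity `f` is infinite at all of them. This is impossible, because `S` provides a function
whose image under `T` lives near `y`, and it can be cut off to a set where `f` is bounded. -/
theorem mem_realcompactification_of_isSupportPoint [T35Space Y]
    {T : C(X, E) →ₗ[𝕜] C(Y, F)} {S : C(Y, F) →ₗ[𝕜] C(X, E)}
    (hT : IsSeparating T) (hS : IsSeparating S) (hST : ∀ f, S (T f) = f) (hTS : ∀ g, T (S g) = g)
    {h : Y → StoneCech X} (hh : ∀ y, IsSupportPoint T stoneCechUnit y (h y)) (y : Y) :
    h y ∈ realcompactification X := by
  intro f hf
  have hh_cont : Continuous h := continuous_of_isSupportPoint hT hh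
  have hβ : Continuous (betaExtend f) := continuous_stoneCechExtend _
  have hβx : ∀ x, betaExtend f (stoneCechUnit x) = (f x : OnePoint ℝ) :=
    stoneCechExtend_stoneCechUnit _
  obtain ⟨u, hu, hconst⟩ := exists_plateau_functions
  obtain ⟨g, -, hgy⟩ := hh y Set.univ Filter.univ_mem
  let G : Bool → C(X, E) := fun i => realMul 𝕜 ⟨fun x => u i |f x|, by fun_prop⟩ g
  obtain ⟨R, hR⟩ := exists_bound_of_eq_smul (𝕜 := 𝕜) (fun i r => (hu i r).1) (fun i => T (G i)) hgy
  have hbound : ∀ᶠ z in 𝓝 y, ∀ r : ℝ, betaExtend f (h z) = r → |r| ≤ R := by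
    filter_upwards [hR] with z hz r hr
    obtain ⟨i, n, hi⟩ := hconst |r|
    refine hz i |r| ?_
    have hG : T (G i) z = T (((u i |r| : ℝ) : 𝕜) • g) z := by
      refine (hh z).map_congr hT ?_
      have h1 : ∀ᶠ s in 𝓝 r, u i |s| = u i |r| := by
        have := continuous_abs.continuousAt.eventually hi
        filter_upwards [this] with s hs
        rw [hs, hi.self_of_nhds]
      have h2 : ∀ᶠ o : OnePoint ℝ in 𝓝 (r : OnePoint ℝ), ∀ s : ℝ, s = o → u i |s| = u i |r| := by
        rw [OnePoint.nhds_coe_eq, Filter.eventually_map]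
        filter_upwards [h1] with s hs s' hs'
        rwa [OnePoint.coe_injective hs']
      rw [← hr] at h2
      filter_upwards [hβ.continuousAt.eventually h2] with q hq x hx
      have := hq (f x) (by rw [← hx, hβx])
      simp [G, this]
    rw [hG, map_smul, ContinuousMap.smul_apply]
  have hinf : ∀ᶠ z in 𝓝 y, betaExtend f (h z) = OnePoint.infty := by
    have hK : ((↑) '' Set.Icc (-R) R : Set (OnePoint ℝ))ᶜ ∈ 𝓝 (betaExtend f (h y)) := by
      rw [hf]
      exact ((isCompact_Icc.image OnePoint.continuous_coe).isClosed.isOpen_compl).mem_nhds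
        (by simp)
    filter_upwards [hbound, (hβ.comp hh_cont).continuousAt.eventually hK] with z hz hzK
    by_contra hne
    obtain ⟨r, hr⟩ := OnePoint.ne_infty_iff_exists.1 hne
    exact hzK ⟨r, abs_le.1 (hz r hr.symm), hr⟩
  obtain ⟨N, ⟨hN, hNc⟩, hNinf⟩ := (closed_nhds_basis y).mem_iff.1 hinf
  obtain ⟨φ, hφy, -, hφ⟩ := exists_bump hN
  -- `g₁` is nonzero and `T g₁` vanishes off `N`. Its cut-off `g₂` below is still nonzero, and it
  -- vanishes near the support point of every `z ∈ N`, where `f` is infinite.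
  let g₁ : C(X, E) := S (realMul 𝕜 φ (T g))
  have hg₁ : ∃ x, g₁ x ≠ 0 := by
    by_contra hcon
    push Not at hcon
    have h0 : g₁ = 0 := ContinuousMap.ext hcon
    have h1 : T g₁ y = T g y := by
      simp only [g₁, hTS, realMul_apply, hφy, one_smul, RCLike.ofReal_one]
    rw [h0, map_zero] at h1
    exact hgy h1.symm
  obtain ⟨x, hx⟩ := hg₁
  obtain ⟨ψ, hψx, -, hψ⟩ := exists_bump (Metric.closedBall_mem_nhds (f x) one_pos)
  let g₂ : C(X, E) := realMul 𝕜 (ψ.comp f) g₁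
  have hg₂ : ∃ z, T g₂ z ≠ 0 := by
    by_contra hcon
    push Not at hcon
    have h0 : T g₂ = 0 := ContinuousMap.ext hcon
    have h1 : g₂ = 0 := by rw [← hST g₂, h0, map_zero]
    have h2 : g₂ x = 0 := by rw [h1]; rfl
    simp [g₂, hψx, hx] at h2
  obtain ⟨z, hz⟩ := hg₂
  have hzN : z ∈ N := by
    have h1 := mem_closure_cozero hT hS hST hTS (f := g₂) (g := g₁)
      (fun x hx => by simp [g₂, hx]) hz
    refine hNc.closure_subset_iff.2 (fun w hw => ?_) h1
    refine hφ w fun h0 => hw ?_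
    simp only [g₁, hTS, realMul_apply, h0, RCLike.ofReal_zero, zero_smul]
  refine hz ((hh z).map_eq_zero hT ?_)
  have hK : ((↑) '' Metric.closedBall (f x) 1 : Set (OnePoint ℝ))ᶜ ∈ 𝓝 (betaExtend f (h z)) := by
    rw [show betaExtend f (h z) = OnePoint.infty from hNinf hzN]
    exact (((isCompact_closedBall _ _).image OnePoint.continuous_coe).isClosed.isOpen_compl).mem_nhds
      (by simp)
  filter_upwards [hβ.continuousAt.eventually hK] with q hq w hw
  have : ψ (f w) = 0 := by
    by_contra h0
    exact hq ⟨f w, hψ _ h0, by rw [← hw, hβx]⟩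
  simp [g₂, this]

end Realcompact

/-! ### The support map and the weighted composition form -/

section SupportMap

variable {𝕜 X Y E F : Type*} [RCLike 𝕜] [TopologicalSpace X] [TopologicalSpace Y]
  [NormedAddCommGroup E] [NormedSpace 𝕜 E] [NormedAddCommGroup F] [NormedSpace 𝕜 F]

/-- Over a realcompact space the support points can be chosen in `X` itself. -/
theorem exists_supportMap [T35Space X] [T35Space Y] (hX : IsRealcompact X)
    {T : C(X, E) →ₗ[𝕜] C(Y, F)} {S : C(Y, F) →ₗ[𝕜] C(X, E)}
    (hT : IsSeparating T) (hS : IsSeparating S) (hST : ∀ f, S (T f) = f) (hTS : ∀ g, T (S g) = g)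
    (hF : Y → Nontrivial F) : ∃ h : Y → X, ∀ y, IsSupportPoint T id y (h y) := by
  have hex : ∀ y, ∃ p, IsSupportPoint T (stoneCechUnit : X → StoneCech X) y p := by
    intro y
    have := hF y
    obtain ⟨v, hv⟩ := exists_ne (0 : F)
    exact exists_isSupportPoint T continuous_stoneCechUnit
      (f := S (ContinuousMap.const Y v)) (by rw [hTS]; exact hv)
  choose p hp using hex
  have hmem : ∀ y, ∃ x, stoneCechUnit x = p y := fun y =>
    hX.subset (mem_realcompactification_of_isSupportPoint hT hS hST hTS hp y)
  choose h hh using hmem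
  refine ⟨h, fun y U hU => ?_⟩
  rw [isEmbedding_stoneCechUnit.isInducing.nhds_eq_comap] at hU
  obtain ⟨V, hV, hVU⟩ := hU
  rw [hh] at hV
  obtain ⟨f, hf, hfy⟩ := hp y V hV
  exact ⟨f, fun x hx => hVU (hf x hx), hfy⟩

/-- The support maps of a biseparating map and of its inverse are inverse to each other. -/
theorem supportMap_comp_supportMap [T35Space X] [T35Space Y]
    {T : C(X, E) →ₗ[𝕜] C(Y, F)} {S : C(Y, F) →ₗ[𝕜] C(X, E)}
    (hT : IsSeparating T) (hS : IsSeparating S) (hST : ∀ f, S (T f) = f) (hTS : ∀ g, T (S g) = g)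
    {h : Y → X} (hh : ∀ y, IsSupportPoint T id y (h y))
    {k : X → Y} (hk : ∀ x, IsSupportPoint S id x (k x)) (x : X) : h (k x) = x := by
  by_contra hne
  obtain ⟨V, U, hV, hU, hxV, hxU, hVU⟩ := t2_separation hne
  have hh_cont : Continuous h := continuous_of_isSupportPoint hT hh
  obtain ⟨N, ⟨hN, hNc⟩, hNV⟩ := (closed_nhds_basis (k x)).mem_iff.1
    (hh_cont.continuousAt.preimage_mem_nhds (hV.mem_nhds hxV))
  obtain ⟨G, hG, hGx⟩ := hk x N hN
  obtain ⟨φ, hφx, -, hφ⟩ := exists_bump (hU.mem_nhds hxU)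
  let g : C(X, E) := realMul 𝕜 φ (S G)
  have hg : ∃ y, T g y ≠ 0 := by
    by_contra hcon
    push Not at hcon
    have h0 : T g = 0 := ContinuousMap.ext hcon
    have h1 : g = 0 := by rw [← hST g, h0, map_zero]
    have h2 : g x = 0 := by rw [h1]; rfl
    simp [g, hφx, hGx] at h2
  obtain ⟨y, hy⟩ := hg
  have hyN : y ∈ N := by
    have h1 := mem_closure_cozero hT hS hST hTS (f := g) (g := S G)
      (fun x hx => by simp [g, hx]) hy
    rw [hTS] at h1
    exact hNc.closure_subset_iff.2 (fun z hz => hG z hz) h1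
  refine hy ((hh y).map_eq_zero hT ?_)
  filter_upwards [hV.mem_nhds (hNV hyN)] with q hq z hz
  have : φ z = 0 := by
    by_contra h0
    have hz' : z = q := hz
    exact Set.disjoint_left.1 hVU hq (hz' ▸ hφ z h0)
  simp [g, this]

open Filter in
/-- For a function `u` of linear growth, `u (‖f‖ ^ (-1/2)) • f` extends continuously by `0` to the
zeros of `f`. -/
theorem continuous_inv_sqrt_norm_smul {u : C(ℝ, ℝ)} (hu : ∀ r, r - 4 ≤ u r ∧ u r ≤ r - 2)
    (f : C(X, E)) : Continuous fun x => ((u (√‖f x‖)⁻¹ : ℝ) : 𝕜) • f x := by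
  rw [continuous_iff_continuousAt]
  intro x
  by_cases hx : f x = 0
  · have h1 : Tendsto (fun z => √‖f z‖ + 4 * ‖f z‖) (𝓝 x) (𝓝 0) := by
      have : Continuous fun z => √‖f z‖ + 4 * ‖f z‖ := by fun_prop
      simpa [hx] using this.tendsto x
    have h2 : Tendsto (fun z => ((u (√‖f z‖)⁻¹ : ℝ) : 𝕜) • f z) (𝓝 x) (𝓝 0) := by
      refine squeeze_zero_norm (fun z => ?_) h1
      rw [norm_smul, RCLike.norm_ofReal]
      have h0 : 0 ≤ √‖f z‖ := Real.sqrt_nonneg _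
      have hr : 0 ≤ (√‖f z‖)⁻¹ := inv_nonneg.2 h0
      have h3 : |u (√‖f z‖)⁻¹| ≤ (√‖f z‖)⁻¹ + 4 := by
        have := hu (√‖f z‖)⁻¹
        exact abs_le.2 ⟨by linarith, by linarith⟩
      have h4 : (√‖f z‖)⁻¹ * ‖f z‖ = √‖f z‖ := by
        rw [inv_mul_eq_div, Real.div_sqrt]
      calc |u (√‖f z‖)⁻¹| * ‖f z‖ ≤ ((√‖f z‖)⁻¹ + 4) * ‖f z‖ :=
            mul_le_mul_of_nonneg_right h3 (norm_nonneg _)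
        _ = √‖f z‖ + 4 * ‖f z‖ := by rw [add_mul, h4]
    simpa [ContinuousAt, hx] using h2
  · have hne : √‖f x‖ ≠ 0 := (Real.sqrt_pos.2 (norm_pos_iff.2 hx)).ne'
    have h1 : ContinuousAt (fun z => (√‖f z‖)⁻¹) x :=
      ContinuousAt.inv₀ (by fun_prop) hne
    have h2 : ContinuousAt (fun z => u (√‖f z‖)⁻¹) x := u.continuous.continuousAt.comp h1
    exact (RCLike.continuous_ofReal.continuousAt.comp h2).smul f.continuous.continuousAt

/-- The value of `T f` at `y` depends only on the value of `f` at the support point of `y`. If `f`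
vanishes there and `T f y ≠ 0`, then multiplying `f` by step functions of `‖f‖ ^ (-1/2)` shows that
`‖f‖` is bounded below on the points near the support point where it is not zero; by continuity
`f` vanishes near the support point. -/
theorem map_eq_zero_of_apply_eq_zero {T : C(X, E) →ₗ[𝕜] C(Y, F)} (hT : IsSeparating T)
    (h : Y ≃ₜ X) (hh : ∀ y, IsSupportPoint T id y (h y)) {f : C(X, E)} {y : Y}
    (hf : f (h y) = 0) : T f y = 0 := by
  by_contra hne
  obtain ⟨u, hu, hconst⟩ := exists_plateau_functions
  let G : Bool → C(X, E) := fun i => ⟨_, continuous_inv_sqrt_norm_smul (𝕜 := 𝕜) (hu i) f⟩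
  obtain ⟨R, hR⟩ := exists_bound_of_eq_smul (𝕜 := 𝕜) (fun i r => (hu i r).1) (fun i => T (G i)) hne
  have hbound : ∀ᶠ z in 𝓝 y, f (h z) ≠ 0 → (√‖f (h z)‖)⁻¹ ≤ R := by
    filter_upwards [hR] with z hz hfz
    obtain ⟨i, n, hi⟩ := hconst (√‖f (h z)‖)⁻¹
    refine hz i _ ?_
    have hG : T (G i) z = T (((u i (√‖f (h z)‖)⁻¹ : ℝ) : 𝕜) • f) z := by
      refine (hh z).map_congr hT ?_
      have hne : √‖f (h z)‖ ≠ 0 := (Real.sqrt_pos.2 (norm_pos_iff.2 hfz)).ne'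
      have hc : ContinuousAt (fun x => (√‖f x‖)⁻¹) (h z) := ContinuousAt.inv₀ (by fun_prop) hne
      filter_upwards [hc.eventually hi] with q hq x hx
      have hx' : x = q := hx
      subst hx'
      simp only [G, ContinuousMap.coe_mk, ContinuousMap.smul_apply]
      rw [hq, hi.self_of_nhds]
    rw [hG, map_smul, ContinuousMap.smul_apply]
  have hsmall : ∀ᶠ z in 𝓝 y, √‖f (h z)‖ < (|R| + 1)⁻¹ := by
    have hc : Continuous fun z => √‖f (h z)‖ := by fun_prop
    refine hc.continuousAt.eventually_lt_const ?_
    simp only [hf, norm_zero, Real.sqrt_zero]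
    positivity
  have hzero : ∀ᶠ z in 𝓝 y, f (h z) = 0 := by
    filter_upwards [hbound, hsmall] with z h1 h2
    by_contra h0
    have hpos : 0 < √‖f (h z)‖ := Real.sqrt_pos.2 (norm_pos_iff.2 h0)
    have h3 := (lt_inv_comm₀ hpos (by positivity)).1 h2
    linarith [h1 h0, le_abs_self R]
  refine hne ((hh y).map_eq_zero hT ?_)
  rw [← h.map_nhds_eq, Filter.eventually_map]
  filter_upwards [hzero] with z hz x hx
  have hx' : x = h z := hx
  rw [hx', hz]

/-- The weight of `T` at `y`: the linear map `e ↦ T e y` on constant functions. -/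
def weight (T : C(X, E) →ₗ[𝕜] C(Y, F)) (y : Y) : E →ₗ[𝕜] F where
  toFun e := T (ContinuousMap.const X e) y
  map_add' a b := by
    rw [show ContinuousMap.const X (a + b) = ContinuousMap.const X a + ContinuousMap.const X b
      from rfl, map_add, ContinuousMap.add_apply]
  map_smul' c a := by
    rw [show ContinuousMap.const X (c • a) = c • ContinuousMap.const X a from rfl, map_smul,
      ContinuousMap.smul_apply, RingHom.id_apply]

theorem map_eq_weight {T : C(X, E) →ₗ[𝕜] C(Y, F)} (hT : IsSeparating T)
    (h : Y ≃ₜ X) (hh : ∀ y, IsSupportPoint T id y (h y)) (f : C(X, E)) (y : Y) :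
    T f y = weight T y (f (h y)) := by
  have := map_eq_zero_of_apply_eq_zero hT h hh (f := f - ContinuousMap.const X (f (h y))) (y := y)
    (by simp)
  rw [map_sub, ContinuousMap.sub_apply, sub_eq_zero] at this
  exact this

end SupportMap

/-! ### Continuity of the weights off the `P`-points -/

section Weight

variable {𝕜 Y E F : Type*} [RCLike 𝕜] [TopologicalSpace Y]
  [NormedAddCommGroup E] [NormedSpace 𝕜 E] [NormedAddCommGroup F] [NormedSpace 𝕜 F]

open Filter in
theorem continuous_ite_inv_sqrt {φ : Y → ℝ} (hφ : Continuous φ) (h0 : ∀ z, 0 ≤ φ z)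
    {c : ℝ → E} (hc : Continuous c) (hc0 : Tendsto c atTop (𝓝 0)) :
    Continuous fun z => if φ z = 0 then 0 else c (√(φ z))⁻¹ := by
  rw [continuous_iff_continuousAt]
  intro y
  by_cases hy : φ y = 0
  · rw [ContinuousAt, if_pos hy]
    refine Tendsto.if tendsto_const_nhds (hc0.comp (tendsto_inv_nhdsGT_zero.comp ?_))
    refine tendsto_nhdsWithin_iff.2 ⟨?_, ?_⟩
    · have : Continuous fun z => √(φ z) := by fun_prop
      have h1 := this.tendsto y
      rw [hy, Real.sqrt_zero] at h1
      exact h1.mono_left inf_le_left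
    · filter_upwards [mem_inf_of_right (mem_principal_self _)] with z hz
      exact Real.sqrt_pos.2 ((h0 z).lt_of_ne' hz)
  · have hne : √(φ y) ≠ 0 := (Real.sqrt_pos.2 ((h0 y).lt_of_ne' hy)).ne'
    have h1 : ContinuousAt (fun z => (√(φ z))⁻¹) y := ContinuousAt.inv₀ (by fun_prop) hne
    have h2 : ContinuousAt (fun z => c (√(φ z))⁻¹) y := hc.continuousAt.comp h1
    refine h2.congr ?_
    filter_upwards [hφ.continuousAt.eventually_ne hy] with z hz
    rw [if_neg hz]

/-- Given neighbourhoods `W n` of `y`, there is a continuous function that vanishes at `y` and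
whose values off `W n` are bounded below by `1 / (n + 1) ^ 2`. -/
theorem exists_continuous_lt_imp_mem [T35Space Y] {y : Y} {W : ℕ → Set Y} (hW : ∀ n, W n ∈ 𝓝 y) :
    ∃ φ : Y → ℝ, Continuous φ ∧ φ y = 0 ∧ (∀ z, 0 ≤ φ z) ∧
      ∀ (n : ℕ) z, φ z < 1 / ((n : ℝ) + 1) ^ 2 → z ∈ W n := by
  choose ψ hψy hψ01 hψ using fun n => exists_bump (hW n)
  have hterm : ∀ (n : ℕ) z, 0 ≤ 1 / ((n : ℝ) + 1) ^ 2 * (1 - ψ n z) := fun n z =>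
    mul_nonneg (by positivity) (by linarith [(hψ01 n z).2])
  have hle : ∀ (n : ℕ) z, 1 / ((n : ℝ) + 1) ^ 2 * (1 - ψ n z) ≤ 1 / ((n : ℝ) + 1) ^ 2 := fun n z =>
    mul_le_of_le_one_right (by positivity) (by linarith [(hψ01 n z).1])
  have hsum : Summable fun n : ℕ => 1 / ((n : ℝ) + 1) ^ 2 := by
    have := (summable_nat_add_iff 1).2 (Real.summable_one_div_nat_pow.2 one_lt_two)
    simpa using this
  refine ⟨fun z => ∑' n : ℕ, 1 / ((n : ℝ) + 1) ^ 2 * (1 - ψ n z), ?_, by simp [hψy],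
    fun z => tsum_nonneg fun n => hterm n z, fun n z hz => ?_⟩
  · refine continuous_tsum (fun n => by fun_prop) hsum fun n z => ?_
    rw [Real.norm_of_nonneg (hterm n z)]
    exact hle n z
  · by_contra hzW
    have h0 : ψ n z = 0 := by
      by_contra h
      exact hzW (hψ n z h)
    have h1 := (Summable.of_nonneg_of_le (fun n => hterm n z) (fun n => hle n z) hsum).le_tsum n
      fun j _ => hterm j z
    rw [h0, sub_zero, mul_one] at h1
    exact absurd hz (not_lt.2 h1)

open Filter in
/-- If linear maps `J z` turn continuous functions into continuous functions, then `J y` is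
continuous at every `y` that is not a `P`-point. Otherwise there are `e n → 0` with
`‖J y (e n)‖ > 1`. As `y` is not a `P`-point, there are functions vanishing at `y` that take
values `e n` at points `z` arbitrarily close to `y` at which `‖J z (e n)‖ > 1` holds as well. -/
theorem continuous_of_not_isPPoint [T35Space Y] (J : Y → E →ₗ[𝕜] F)
    (hJ : ∀ f : C(Y, E), Continuous fun z => J z (f z)) {y : Y} (hy : ¬ IsPPoint y) :
    Continuous (J y) := by
  let _ : NormedSpace ℝ E := NormedSpace.restrictScalars ℝ 𝕜 E
  by_contra hcon
  have hex : ∀ n : ℕ, ∃ e : E, ‖e‖ ≤ 1 / ((n : ℝ) + 1) ∧ 1 < ‖J y e‖ := by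
    intro n
    by_contra hn
    push Not at hn
    have hpos : (0 : ℝ) < 1 / ((n : ℝ) + 1) := by positivity
    obtain ⟨C, hC⟩ := LinearMap.bound_of_ball_bound hpos 1 (J y)
      fun z hz => hn z (mem_ball_zero_iff.1 hz).le
    exact hcon (AddMonoidHomClass.continuous_of_bound (J y) C hC)
  choose e he heJ using hex
  have he0 : Tendsto (fun n : ℤ => e n.toNat) atTop (𝓝 0) := by
    have h1 : Tendsto e atTop (𝓝 0) :=
      squeeze_zero_norm he tendsto_one_div_add_atTop_nhds_zero_nat
    refine h1.comp (tendsto_atTop.2 fun m => ?_)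
    filter_upwards [eventually_ge_atTop (m : ℤ)] with n hn
    omega
  obtain ⟨P, hP, hP0⟩ := exists_continuous_interpolation _ he0
  obtain ⟨u, hu, hconst⟩ := exists_plateau_functions
  have hV : ∀ n, {z | 1 < ‖J z (e n)‖} ∈ 𝓝 y := fun n =>
    (hJ (ContinuousMap.const Y (e n))).norm.continuousAt.eventually_const_lt (heJ n)
  simp only [IsPPoint, not_forall] at hy
  obtain ⟨W, hW, hWy⟩ := hy
  obtain ⟨φ, hφ, hφy, hφ0, hφW⟩ :=
    exists_continuous_lt_imp_mem fun n => inter_mem (hW n) (hV n)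
  let f : Bool → C(Y, E) := fun i => ⟨_, continuous_ite_inv_sqrt hφ hφ0
    (P.continuous.comp (u i).continuous) (hP0.comp (tendsto_atTop_mono (fun r => (hu i r).1)
      (tendsto_atTop_add_const_right _ (-4) tendsto_id)))⟩
  have hfy : ∀ᶠ z in 𝓝 y, ∀ i, ‖J z (f i z)‖ < 1 := by
    refine eventually_all.2 fun i => (hJ (f i)).norm.continuousAt.eventually_lt_const ?_
    simp [f, hφy]
  have hφ1 : ∀ᶠ z in 𝓝 y, φ z < 1 := hφ.continuousAt.eventually_lt_const (by simp [hφy])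
  obtain ⟨z, ⟨hz1, hzφ⟩, hzW⟩ : ∃ z, ((∀ i, ‖J z (f i z)‖ < 1) ∧ φ z < 1) ∧ z ∉ ⋂ n, W n := by
    by_contra hno
    push Not at hno
    exact hWy (mem_of_superset (hfy.and hφ1) hno)
  have hne : φ z ≠ 0 := by
    intro h0
    refine hzW (Set.mem_iInter.2 fun n => (hφW n z ?_).1)
    rw [h0]
    positivity
  have hs : 0 < √(φ z) := Real.sqrt_pos.2 ((hφ0 z).lt_of_ne' hne)
  obtain ⟨i, n, hi⟩ := hconst (√(φ z))⁻¹
  have hun : u i (√(φ z))⁻¹ = n := hi.self_of_nhds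
  have hfz : f i z = e n.toNat := by
    simp [f, hne, hun, hP]
  -- This uses `n ≤ r - 2` for `r = (φ z) ^ (-1/2)`, and `φ z < 1` if `n` is negative.
  have hlt : (n.toNat : ℝ) + 1 < (√(φ z))⁻¹ := by
    rcases le_total 0 n with hn | hn
    · have h1 : ((n.toNat : ℤ) : ℝ) = n := by rw [Int.toNat_of_nonneg hn]
      have h2 := (hu i (√(φ z))⁻¹).2
      rw [hun, ← h1] at h2
      push_cast at h2
      linarith
    · rw [Int.toNat_of_nonpos hn]
      have : √(φ z) < 1 := by simpa using Real.sqrt_lt_sqrt (hφ0 z) hzφ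
      simpa using (one_lt_inv₀ hs).2 this
  have hzV : 1 < ‖J z (e n.toNat)‖ := by
    refine (hφW n.toNat z ?_).2
    have h1 : √(φ z) < ((n.toNat : ℝ) + 1)⁻¹ := (lt_inv_comm₀ (by positivity) hs).1 hlt
    rw [one_div, ← inv_pow]
    exact (Real.sqrt_lt' (by positivity)).1 h1
  have := hz1 i
  rw [hfz] at this
  exact absurd hzV (not_lt.2 this.le)

end Weight

/-! ### Construction of biseparating maps -/

section Construction

variable {𝕜 X Y E F : Type*} [RCLike 𝕜] [TopologicalSpace X] [TopologicalSpace Y]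
  [NormedAddCommGroup E] [NormedSpace 𝕜 E] [NormedAddCommGroup F] [NormedSpace 𝕜 F]

/-- Every function of a continuous metric-valued function on a `P`-space is continuous, because
the latter is locally constant. -/
theorem continuous_comp_of_isPPoint {M N : Type*} [MetricSpace M] [TopologicalSpace N]
    (hY : ∀ y : Y, IsPPoint y) {f : Y → M} (hf : Continuous f) (L : M → N) :
    Continuous fun y => L (f y) := by
  rw [continuous_iff_continuousAt]
  intro y
  have h1 := hY y (fun n => {z | dist (f z) (f y) < 1 / ((n : ℝ) + 1)}) fun n =>
    (hf.dist continuous_const).continuousAt.eventually_lt_const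
      (by simp only [dist_self]; positivity)
  refine ContinuousAt.congr (continuousAt_const (y := L (f y))) ?_
  filter_upwards [h1] with z hz
  have : f z = f y := by
    rw [← dist_le_zero]
    refine ge_of_tendsto' tendsto_one_div_add_atTop_nhds_zero_nat fun n => ?_
    exact (Set.mem_iInter.1 hz n).le
  rw [this]

theorem exists_isBiseparating (φ : X ≃ₜ Y) (L : E ≃ₗ[𝕜] F)
    (hL : ∀ f : C(Y, E), Continuous fun y => L (f y))
    (hL' : ∀ g : C(Y, F), Continuous fun y => L.symm (g y)) :
    ∃ T : C(X, E) →ₗ[𝕜] C(Y, F), IsBiseparating T := by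
  let T : C(X, E) →ₗ[𝕜] C(Y, F) :=
    { toFun f := ⟨fun y => L (f (φ.symm y)), hL (f.comp ⟨φ.symm, φ.symm.continuous⟩)⟩
      map_add' f g := by ext y; simp
      map_smul' c f := by ext y; simp }
  let S : C(Y, F) →ₗ[𝕜] C(X, E) :=
    { toFun g := ⟨fun x => L.symm (g (φ x)), (hL' g).comp φ.continuous⟩
      map_add' f g := by ext y; simp
      map_smul' c f := by ext y; simp }
  refine ⟨T, fun f g h y => ?_, S, ?_, ?_, fun f g h x => ?_⟩
  · have := h (φ.symm y)
    simpa [T] using this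
  · ext f x
    simp [T, S]
  · ext g y
    simp [T, S]
  · have := h (φ x)
    simpa [S] using this

end Construction

/-! ### Characterization of the existence of biseparating maps -/

theorem mainTheorem3 {𝕜 : Type*} [RCLike 𝕜]
    {X : Type*} [TopologicalSpace X] [T35Space X] [Nonempty X]
    {Y : Type*} [TopologicalSpace Y] [T35Space Y]
    {E : Type uE} [NormedAddCommGroup E] [NormedSpace 𝕜 E] [Nontrivial E]
    {F : Type uF} [NormedAddCommGroup F] [NormedSpace 𝕜 F]
    (hX : IsRealcompact X) (hY : IsRealcompact Y) :
    (∃ T : C(X, E) →ₗ[𝕜] C(Y, F), IsBiseparating T) ↔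
      Nonempty (X ≃ₜ Y) ∧
        (Nonempty (E ≃L[𝕜] F) ∨
          (Cardinal.lift.{uF} (Module.rank 𝕜 E) = Cardinal.lift.{uE} (Module.rank 𝕜 F) ∧
            IsPSpace Y)) := by
  constructor
  · rintro ⟨T, hT, S, hST, hTS, hS⟩
    replace hST : ∀ f, S (T f) = f := fun f => LinearMap.congr_fun hST f
    replace hTS : ∀ g, T (S g) = g := fun g => LinearMap.congr_fun hTS g
    have hF : Y → Nontrivial F := by
      intro _
      by_contra hF
      rw [not_nontrivial_iff_subsingleton] at hF
      obtain ⟨e, he⟩ := exists_ne (0 : E)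
      obtain ⟨x⟩ := ‹Nonempty X›
      have h1 : T (ContinuousMap.const X e) = 0 :=
        ContinuousMap.ext fun y => Subsingleton.elim _ _
      have h2 := hST (ContinuousMap.const X e)
      rw [h1, map_zero] at h2
      exact he (DFunLike.congr_fun h2 x).symm
    obtain ⟨h, hh⟩ := exists_supportMap hX hT hS hST hTS hF
    obtain ⟨k, hk⟩ := exists_supportMap hY hS hT hTS hST fun _ => inferInstance
    let H : Y ≃ₜ X :=
      { toFun := h
        invFun := k
        left_inv := supportMap_comp_supportMap hS hT hTS hST hk hh
        right_inv := supportMap_comp_supportMap hT hS hST hTS hh hk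
        continuous_toFun := continuous_of_isSupportPoint hT hh
        continuous_invFun := continuous_of_isSupportPoint hS hk }
    have hTw : ∀ f y, T f y = weight T y (f (H y)) := map_eq_weight hT H hh
    have hSw : ∀ g x, S g x = weight S x (g (H.symm x)) := map_eq_weight hS H.symm hk
    let L : Y → (E ≃ₗ[𝕜] F) := fun y => LinearEquiv.ofLinearMap (weight T y) (weight S (H y))
      (LinearMap.ext fun v => by
        have := hTw (S (ContinuousMap.const Y v)) y
        rw [hTS] at this
        exact this.symm)
      (LinearMap.ext fun e => by
        have := hSw (T (ContinuousMap.const X e)) (H y)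
        rw [hST, H.symm_apply_apply] at this
        exact this.symm)
    refine ⟨⟨H.symm⟩, ?_⟩
    by_cases hP : ∀ y : Y, IsPPoint y
    · right
      obtain ⟨x⟩ := ‹Nonempty X›
      exact ⟨(L (k x)).lift_rank_eq, ‹_›, hP⟩
    · left
      push Not at hP
      obtain ⟨y, hy⟩ := hP
      have h1 : Continuous (L y) := continuous_of_not_isPPoint (weight T)
        (fun f => by
          have := (T (f.comp ⟨H.symm, H.symm.continuous⟩)).continuous
          refine this.congr fun z => ?_
          rw [hTw]
          simp) hy
      have h2 : Continuous (L y).symm := continuous_of_not_isPPoint (fun z => weight S (H z))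
        (fun g => by
          refine ((S g).continuous.comp H.continuous).congr fun z => ?_
          rw [Function.comp_apply, hSw, H.symm_apply_apply]) hy
      exact ⟨⟨L y, h1, h2⟩⟩
  · rintro ⟨⟨φ⟩, ⟨⟨L⟩⟩ | ⟨hrank, -, hP⟩⟩
    · exact exists_isBiseparating φ L.toLinearEquiv (fun f => L.continuous.comp f.continuous)
        fun g => L.symm.continuous.comp g.continuous
    · obtain ⟨L⟩ := nonempty_linearEquiv_of_lift_rank_eq hrank
      exact exists_isBiseparating φ L (fun f => continuous_comp_of_isPPoint hP f.continuous L)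
        fun g => continuous_comp_of_isPPoint hP g.continuous L.symm
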